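/- Let $\mathbb{F}_q$ be a finite field, let $S_1,\dots,S_m\subseteq\mathbb{F}_q$ with $s_i=\#S_i$, and choose integers $0\le v_i<j_i<s_i$ for $i=1,\dots,m$. Put $S=S_1\times\cdots\times S_m$, $n=\#S=s_1\cdots s_m$, and $$\Delta=\{X_1^{i_1}\cdots X_m^{i_m}\mid 0\le i_t<s_t\},\qquad L_1=\{X_1^{i_1}\cdots X_m^{i_m}\mid 0\le i_t\le j_t\},$$ $$\Box=\{X_1^{i_1}\cdots X_m^{i_m}\mid v_t\le i_t\le j_t\},\qquad L_2=L_1\setminus\Box .$$ For $L\subseteq\Delta$ let $C(L)\subseteq\mathbb{F}_q^{S}$ be the span of the evaluation vectors $(M(\alpha))_{\alpha\in S}$, $M\in L$. For $K\subseteq\Delta$ let $D(K)$ be the number of monomials in $\Delta$ that are divisible by some element of $K$. Let $\prec$ be the lexicographic ordering with $X_m\prec\cdots\prec X_1$ and let $\Diamond=\{M\in L_1\mid X_1^{v_1}\cdots X_m^{v_m}\preceq M\}$. Assume that the scheme is considerate: for every $i=1,\dots,\#\Box$, the minimum of $D(K)$ over all $K\subseteq\Diamond$ with $\#K=i$ is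 attained by some $K'\subseteq\Box$. Consider a linear ramp secret sharing scheme defined from $C_2=C(L_2)\subseteq C_1=C(L_1)$: choose a basis $b_1,\dots,b_{k_2}$ of $C_2$ and extend it by $b_{k_2+1},\dots,b_{k_2+\ell}$ to a basis of $C_1$. A secret $(x_1,\dots,x_\ell)\in\mathbb{F}_q^\ell$ is encoded as $c=\sum_{i\le k_2}a_ib_i+\sum_{i\le\ell}x_ib_{k_2+i}$ with $a\in\mathbb{F}_q^{k_2}$ random, and participant $\alpha\in S$ receives the share $c_\alpha$. For a set $A\subseteq S$ of participants the secrets in accordance with their shares form a coset $p+V\subseteq\mathbb{F}_q^\ell$, and $A$ is said to recover $u$ $q$-bits of information if $\ell-\dim V\ge u$. Let $r_u$ be the smallest number such that every set of $r_u$ participants recovers $u$ $q$-bits; call $A$ non-$u$-qualifying if it does not recover $u$ $q$-bits, and maximum non-$u$-qualifying if it has the largest size among the non-$u$-qualifying sets. Then $\ell=\#\Box$, and $$r_1=\prod_{i=1}^m s_i-\prod_{i=1}^m(s_i-v_i)+1,\qquad r_\ell=\prod_{i=1}^m s_i-\prod_{i=1}^m(s_i-j_i)+1 .$$ For all $T^{(i)}_{\max}\subseteq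 S_i$ with $\#T^{(i)}_{\max}=s_i-v_i$ ($i=1,\dots,m$), the set $S\setminus(T^{(1)}_{\max}\times\cdots\times T^{(m)}_{\max})$ is maximum non-$1$-qualifying. A set $A\subseteq S$ is maximum non-$\ell$-qualifying if and only if $A=S\setminus(T^{(1)}_{\min}\times\cdots\times T^{(m)}_{\min})$ for some $T^{(i)}_{\min}\subseteq S_i$ with $\#T^{(i)}_{\min}=s_i-j_i$ ($i=1,\dots,m$). -/

import Mathlib

open scoped MonomialOrder

/-! ### Linear ramp secret sharing schemes from nested codes -/

/-- The data of the coset construction for nested codes `C₂ ⊆ C₁ ⊆ F^ι` of codimension `ℓ`: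
a basis `b` of `C₂` together with vectors `e` such that `b` followed by `e` is a basis of `C₁`.
The participants are the elements of `ι`. -/
structure RampScheme {F ι : Type*} [Field F] (C₂ C₁ : Submodule F (ι → F)) (k₂ ℓ : ℕ) where
  b : Fin k₂ → ι → F
  e : Fin ℓ → ι → F
  linearIndependent : LinearIndependent F (Sum.elim b e)
  span_b : Submodule.span F (Set.range b) = C₂
  span_b_e : Submodule.span F (Set.range (Sum.elim b e)) = C₁

namespace RampScheme

variable {F ι : Type*} [Field F] {C₂ C₁ : Submodule F (ι → F)} {k₂ ℓ : ℕ}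

/-- The vector of shares of the secret `s` for the random choice `a`. -/
def encode (σ : RampScheme C₂ C₁ k₂ ℓ) (a : Fin k₂ → F) (s : Fin ℓ → F) : ι → F :=
  ∑ i, a i • σ.b i + ∑ i, s i • σ.e i

/-- The secrets that are in accordance with the shares `c p`, `p ∈ A`. -/
def possibleSecrets (σ : RampScheme C₂ C₁ k₂ ℓ) (A : Finset ι) (c : ι → F) :
    Set (Fin ℓ → F) :=
  {s | ∃ a : Fin k₂ → F, ∀ p ∈ A, σ.encode a s p = c p}

/-- The number of `q`-bits of information that `A` holds when the shares are given by `c`: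
the possible secrets form a coset `p + V`, and the information is `ℓ - dim V`. -/
noncomputable def information (σ : RampScheme C₂ C₁ k₂ ℓ) (A : Finset ι) (c : ι → F) : ℕ :=
  ℓ - Module.finrank F (vectorSpan F (σ.possibleSecrets A c))

/-- `A` can recover `i` `q`-bits of information (whatever the secret and the randomness). -/
def Recovers (σ : RampScheme C₂ C₁ k₂ ℓ) (i : ℕ) (A : Finset ι) : Prop :=
  ∀ (a : Fin k₂ → F) (s : Fin ℓ → F), i ≤ σ.information A (σ.encode a s)

/-- `r` is the `i`-th reconstruction number `r_i`: the smallest number such that any set of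
`r` participants can recover `i` `q`-bits of information. -/
def IsReconstructionNumber (σ : RampScheme C₂ C₁ k₂ ℓ) (i r : ℕ) : Prop :=
  IsLeast {r : ℕ | ∀ A : Finset ι, A.card = r → σ.Recovers i A} r

/-- `A` is non-`i`-qualifying. -/
def NonQualifying (σ : RampScheme C₂ C₁ k₂ ℓ) (i : ℕ) (A : Finset ι) : Prop :=
  ¬ σ.Recovers i A

/-- `A` is a non-`i`-qualifying set of largest possible size. -/
def MaximumNonQualifying (σ : RampScheme C₂ C₁ k₂ ℓ) (i : ℕ) (A : Finset ι) : Prop :=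
  σ.NonQualifying i A ∧ ∀ B : Finset ι, σ.NonQualifying i B → B.card ≤ A.card

end RampScheme

/-! ### Monomial-Cartesian codes -/

namespace MonomialCartesian

/-- The point set `S₁ × ⋯ × Sₘ` as a type. -/
abbrev Points {F : Type*} {m : ℕ} (S : Fin m → Finset F) : Type _ :=
  ↥(Fintype.piFinset S)

/-- The subset `T₁ × ⋯ × Tₘ` of `S₁ × ⋯ × Sₘ`. -/
def prodSet {F : Type*} [DecidableEq F] {m : ℕ} (S T : Fin m → Finset F) :
    Finset (Points S) :=
  Finset.univ.filter fun x => ∀ i, x.1 i ∈ T i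

/-- Evaluation of polynomials at the points of `S₁ × ⋯ × Sₘ`. -/
noncomputable def ev {F : Type*} [Field F] {m : ℕ} (S : Fin m → Finset F) :
    MvPolynomial (Fin m) F →ₗ[F] (Points S → F) :=
  LinearMap.pi fun x => (MvPolynomial.aeval x.1).toLinearMap

/-- The code `C(L)`; a monomial is represented by its exponent vector. -/
noncomputable def code {F : Type*} [Field F] {m : ℕ} (S : Fin m → Finset F)
    (L : Finset (Fin m →₀ ℕ)) : Submodule F (Points S → F) :=
  (Submodule.span F
    ((fun M : Fin m →₀ ℕ => MvPolynomial.monomial M (1 : F)) '' (L : Set (Fin m →₀ ℕ)))).map (ev S)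

/-- `Δ(s₁, …, sₘ)`: the monomials with `i`-th exponent smaller than `sᵢ`. -/
noncomputable def delta {m : ℕ} (s : Fin m → ℕ) : Finset (Fin m →₀ ℕ) :=
  Finset.univ.finsupp fun i => Finset.range (s i)

open Classical in
/-- `D(K)`: the number of monomials in `Δ(s₁, …, sₘ)` divisible by some monomial in `K`. -/
noncomputable def D {m : ℕ} (s : Fin m → ℕ) (K : Finset (Fin m →₀ ℕ)) : ℕ :=
  ((delta s).filter fun N => ∃ M ∈ K, M ≤ N).card

/-! ### Considerate schemes -/

/-- `L₁`: all monomials dividing `X₁^{j₁} ⋯ Xₘ^{jₘ}`. -/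
noncomputable def L₁ {m : ℕ} (j : Fin m →₀ ℕ) : Finset (Fin m →₀ ℕ) :=
  Finset.Iic j

/-- `□`: the monomials with `i`-th exponent between `vᵢ` and `jᵢ`. -/
noncomputable def box {m : ℕ} (v j : Fin m →₀ ℕ) : Finset (Fin m →₀ ℕ) :=
  Finset.Icc v j

/-- `L₂ = L₁ \ □`. -/
noncomputable def L₂ {m : ℕ} (v j : Fin m →₀ ℕ) : Finset (Fin m →₀ ℕ) :=
  L₁ j \ box v j

open Classical in
/-- `◇`: the monomials of `L₁` that are at least `X₁^{v₁} ⋯ Xₘ^{vₘ}` in the lexicographic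
ordering with `Xₘ ≺ ⋯ ≺ X₁`. -/
noncomputable def diamond {m : ℕ} (v j : Fin m →₀ ℕ) : Finset (Fin m →₀ ℕ) :=
  (L₁ j).filter fun M => v ≼[MonomialOrder.lex] M

/-- For every `i = 1, …, #□`, the minimum of `D(K)` over the `K ⊆ ◇` of size `i` is attained
by some `K' ⊆ □`. -/
def Considerate {m : ℕ} (s : Fin m → ℕ) (v j : Fin m →₀ ℕ) : Prop :=
  ∀ i : ℕ, 1 ≤ i → i ≤ (box v j).card →
    ∃ K' : Finset (Fin m →₀ ℕ), K' ⊆ box v j ∧ K'.card = i ∧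
      ∀ K : Finset (Fin m →₀ ℕ), K ⊆ diamond v j → K.card = i → D s K' ≤ D s K

end MonomialCartesian


/-!
Write `V_A` for the space of words vanishing on the participant set `A`. The secrets compatible with
the shares of `A` form a coset of the image of `C₁ ⊓ V_A` in `C₁ / C₂`, so `A` learns nothing iff
`C₁ ≤ C₂ ⊔ V_A`, and `A` fails to learn the whole secret iff `¬ C₁ ⊓ V_A ≤ C₂`.

The first condition survives raising the corner `j` of `L₁` while `v` stays fixed: a new monomial
is `Xᵢ` times an old one, hence agrees on `A` with a combination of the `Xᵢ M`, `M ∈ L₂`, and those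
`Xᵢ M` that lie in the new box lie in the old one already. Raising `j` to `s - 1` makes `C₁` the
whole space, and `#A ≤ dim C₂` follows. Conversely, on the complement of `T₁ × ⋯ × Tₘ` with
`#(Sᵢ \ Tᵢ) = vᵢ` the polynomial `∏ᵢ ∏_{a ∈ Sᵢ \ Tᵢ} (Xᵢ - a)` vanishes; its leading monomial is
`X^v`, so the condition holds for `j = v`, hence for every `j ≥ v`.

For the second condition, a polynomial with exponents at most `j` has at least `sᵢ - jᵢ` non-zeros
on each line in direction `i` through one of its non-zeros. A set that meets its axis-parallel lines
in at least `dᵢ` points has at least `∏ᵢ dᵢ` points, with equality only for products.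
-/

/-- The words that vanish on the coordinates in `A`, encoded as the kernel of the restriction
to `A`. -/
def vanishingWords {ι : Type*} (R : Type*) [Semiring R] (A : Finset ι) : Submodule R (ι → R) :=
  LinearMap.ker (LinearMap.funLeft R R (Subtype.val : A → ι))

section vanishingWords

variable {R F ι : Type*}

theorem mem_vanishingWords [Semiring R] {A : Finset ι} {c : ι → R} :
    c ∈ vanishingWords R A ↔ ∀ p ∈ A, c p = 0 := by
  simp [vanishingWords, funext_iff, LinearMap.funLeft_apply]

theorem vanishingWords_anti [Semiring R] {A B : Finset ι} (h : B ⊆ A) :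
    vanishingWords R A ≤ vanishingWords R B := fun _ hc =>
  mem_vanishingWords.2 fun p hp => mem_vanishingWords.1 hc p (h hp)

theorem mul_mem_vanishingWords [Semiring R] {A : Finset ι} (c : ι → R) {d : ι → R}
    (hd : d ∈ vanishingWords R A) : c * d ∈ vanishingWords R A :=
  mem_vanishingWords.2 fun p hp => by rw [Pi.mul_apply, mem_vanishingWords.1 hd p hp, mul_zero]

theorem card_le_finrank_of_sup_vanishingWords_eq_top [Field F] [Finite ι] {A : Finset ι}
    {C : Submodule F (ι → F)} (h : C ⊔ vanishingWords F A = ⊤) :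
    A.card ≤ Module.finrank F C := by
  have hsurj : LinearMap.range (LinearMap.funLeft F F (Subtype.val : A → ι)) = ⊤ :=
    LinearMap.range_eq_top.2 (LinearMap.funLeft_surjective_of_injective _ _ _
      Subtype.val_injective)
  have hmap : C.map (LinearMap.funLeft F F (Subtype.val : A → ι)) = ⊤ :=
    (LinearMap.map_eq_top_iff hsurj).2 h
  calc A.card = Module.finrank F (C.map (LinearMap.funLeft F F (Subtype.val : A → ι))) := by
        rw [hmap, finrank_top, Module.finrank_fintype_fun_eq_card, Fintype.card_coe]
    _ ≤ Module.finrank F C := Submodule.finrank_map_le _ _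

end vanishingWords

namespace RampScheme

variable {F ι : Type*} [Field F] {C₂ C₁ : Submodule F (ι → F)} {k₂ ℓ : ℕ}

/-- The map `encode` as a linear map of randomness and secret. -/
def encodeLinear (σ : RampScheme C₂ C₁ k₂ ℓ) : (Fin k₂ → F) × (Fin ℓ → F) →ₗ[F] ι → F :=
  (Fintype.linearCombination F σ.b).coprod (Fintype.linearCombination F σ.e)

theorem encodeLinear_apply (σ : RampScheme C₂ C₁ k₂ ℓ) (x : (Fin k₂ → F) × (Fin ℓ → F)) :
    σ.encodeLinear x = σ.encode x.1 x.2 := rfl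

theorem encodeLinear_injective (σ : RampScheme C₂ C₁ k₂ ℓ) :
    Function.Injective σ.encodeLinear := by
  refine (injective_iff_map_eq_zero _).2 fun ⟨a, s⟩ h => ?_
  have hcoeff := Fintype.linearIndependent_iff.1 σ.linearIndependent (Sum.elim a s) (by
    simpa [encodeLinear_apply, encode] using h)
  exact Prod.ext (funext fun i => hcoeff (Sum.inl i)) (funext fun i => hcoeff (Sum.inr i))

theorem range_encodeLinear (σ : RampScheme C₂ C₁ k₂ ℓ) : LinearMap.range σ.encodeLinear = C₁ := by
  rw [encodeLinear, LinearMap.range_coprod, Fintype.range_linearCombination,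
    Fintype.range_linearCombination, ← Submodule.span_union, ← Set.Sum.elim_range, σ.span_b_e]

theorem map_encodeLinear_ker_snd (σ : RampScheme C₂ C₁ k₂ ℓ) :
    (LinearMap.ker (LinearMap.snd F (Fin k₂ → F) (Fin ℓ → F))).map σ.encodeLinear = C₂ := by
  rw [LinearMap.ker_snd, ← LinearMap.range_comp, encodeLinear, LinearMap.coprod_inl,
    Fintype.range_linearCombination, σ.span_b]

theorem finrank_eq_add (σ : RampScheme C₂ C₁ k₂ ℓ) :
    Module.finrank F C₁ = Module.finrank F C₂ + ℓ := by
  have hb : LinearIndependent F σ.b := σ.linearIndependent.comp Sum.inl Sum.inl_injective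
  have hC₂ := finrank_span_eq_card hb
  have hC₁ := finrank_span_eq_card σ.linearIndependent
  rw [σ.span_b] at hC₂
  rw [σ.span_b_e, Fintype.card_sum] at hC₁
  rw [hC₁, hC₂, Fintype.card_fin ℓ]

/-- The direction `V` of the coset `p + V` of secrets in accordance with the shares of `A`. -/
def hiddenSecrets (σ : RampScheme C₂ C₁ k₂ ℓ) (A : Finset ι) : Submodule F (Fin ℓ → F) :=
  ((vanishingWords F A).comap σ.encodeLinear).map (LinearMap.snd F _ _)

theorem possibleSecrets_encode (σ : RampScheme C₂ C₁ k₂ ℓ) (A : Finset ι) (a : Fin k₂ → F)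
    (s : Fin ℓ → F) :
    σ.possibleSecrets A (σ.encode a s) = AffineSubspace.mk' s (σ.hiddenSecrets A) := by
  ext s'
  have hsub : ∀ a', σ.encodeLinear (a' - a, s' - s) = σ.encode a' s' - σ.encode a s :=
    fun a' => map_sub σ.encodeLinear (a', s') (a, s)
  simp only [SetLike.mem_coe, AffineSubspace.mem_mk', vsub_eq_sub, hiddenSecrets,
    Submodule.mem_map, Submodule.mem_comap, mem_vanishingWords, possibleSecrets, Set.mem_ofPred_eq]
  constructor
  · rintro ⟨a', ha'⟩
    exact ⟨(a' - a, s' - s), fun p hp => by simp [hsub, ha' p hp], rfl⟩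
  · rintro ⟨⟨b, t⟩, hb, rfl : t = s' - s⟩
    refine ⟨b + a, fun p hp => sub_eq_zero.1 ?_⟩
    rw [← Pi.sub_apply, ← hsub, add_sub_cancel_right]
    exact hb p hp

theorem recovers_iff {σ : RampScheme C₂ C₁ k₂ ℓ} {i : ℕ} {A : Finset ι} :
    σ.Recovers i A ↔ i ≤ ℓ - Module.finrank F (σ.hiddenSecrets A) := by
  have hspan : ∀ a s, vectorSpan F (σ.possibleSecrets A (σ.encode a s)) = σ.hiddenSecrets A :=
    fun a s => by
      rw [possibleSecrets_encode, ← AffineSubspace.direction_eq_vectorSpan,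
        AffineSubspace.direction_mk']
  have hinfo : ∀ a s,
      σ.information A (σ.encode a s) = ℓ - Module.finrank F (σ.hiddenSecrets A) :=
    fun a s => by rw [information, hspan]
  simp only [Recovers, hinfo, forall_const]

theorem hiddenSecrets_anti (σ : RampScheme C₂ C₁ k₂ ℓ) {A B : Finset ι} (h : B ⊆ A) :
    σ.hiddenSecrets A ≤ σ.hiddenSecrets B :=
  Submodule.map_mono (Submodule.comap_mono (vanishingWords_anti h))

theorem finrank_hiddenSecrets_le (σ : RampScheme C₂ C₁ k₂ ℓ) (A : Finset ι) :
    Module.finrank F (σ.hiddenSecrets A) ≤ ℓ := by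
  simpa using (σ.hiddenSecrets A).finrank_le

theorem NonQualifying.mono {σ : RampScheme C₂ C₁ k₂ ℓ} {i : ℕ} {A B : Finset ι}
    (hA : σ.NonQualifying i A) (h : B ⊆ A) : σ.NonQualifying i B := by
  rw [NonQualifying, recovers_iff] at *
  have hfinrank := Submodule.finrank_mono (σ.hiddenSecrets_anti h)
  omega

theorem hiddenSecrets_eq_top_iff {σ : RampScheme C₂ C₁ k₂ ℓ} {A : Finset ι} :
    σ.hiddenSecrets A = ⊤ ↔ C₁ ≤ C₂ ⊔ vanishingWords F A := by
  have hC₂ : C₂ ≤ C₁ := σ.map_encodeLinear_ker_snd.ge.trans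
    (LinearMap.map_le_range.trans σ.range_encodeLinear.le)
  rw [hiddenSecrets, LinearMap.map_eq_top_iff (LinearMap.range_eq_top.2 Prod.snd_surjective),
    ← top_le_iff, ← Submodule.map_le_map_iff_of_injective σ.encodeLinear_injective,
    Submodule.map_top, Submodule.map_sup, Submodule.map_comap_eq, σ.map_encodeLinear_ker_snd,
    σ.range_encodeLinear, sup_comm, inf_comm, ← sup_inf_assoc_of_le _ hC₂, le_inf_iff,
    and_iff_left le_rfl]

theorem hiddenSecrets_eq_bot_iff {σ : RampScheme C₂ C₁ k₂ ℓ} {A : Finset ι} :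
    σ.hiddenSecrets A = ⊥ ↔ C₁ ⊓ vanishingWords F A ≤ C₂ := by
  rw [hiddenSecrets, ← LinearMap.le_ker_iff_map,
    ← Submodule.map_le_map_iff_of_injective σ.encodeLinear_injective, Submodule.map_comap_eq,
    σ.map_encodeLinear_ker_snd, σ.range_encodeLinear]

theorem nonQualifying_one_iff {σ : RampScheme C₂ C₁ k₂ ℓ} {A : Finset ι} :
    σ.NonQualifying 1 A ↔ C₁ ≤ C₂ ⊔ vanishingWords F A := by
  have hle := σ.finrank_hiddenSecrets_le A
  have htop : σ.hiddenSecrets A = ⊤ ↔ Module.finrank F (σ.hiddenSecrets A) = ℓ := by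
    refine ⟨fun h => ?_, fun h => Submodule.eq_top_of_finrank_eq ?_⟩
    · rw [h, finrank_top, Module.finrank_fin_fun]
    · rw [h, Module.finrank_fin_fun]
  rw [← hiddenSecrets_eq_top_iff (σ := σ), htop, NonQualifying, recovers_iff]
  omega

theorem nonQualifying_codim_iff {σ : RampScheme C₂ C₁ k₂ ℓ} {A : Finset ι} :
    σ.NonQualifying ℓ A ↔ ¬ C₁ ⊓ vanishingWords F A ≤ C₂ := by
  have hle := σ.finrank_hiddenSecrets_le A
  rw [← hiddenSecrets_eq_bot_iff (σ := σ), ← Submodule.finrank_eq_zero (R := F), NonQualifying,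
    recovers_iff]
  omega

section IsGreatest

variable {σ : RampScheme C₂ C₁ k₂ ℓ} {i N : ℕ}
  (hN : IsGreatest {n | ∃ A : Finset ι, σ.NonQualifying i A ∧ A.card = n} N)
include hN

theorem maximumNonQualifying_iff_of_isGreatest {A : Finset ι} :
    σ.MaximumNonQualifying i A ↔ σ.NonQualifying i A ∧ A.card = N := by
  obtain ⟨⟨A₀, hA₀, hcard⟩, hmax⟩ := hN
  refine and_congr_right fun hA => ⟨fun h => (hmax ⟨A, hA, rfl⟩).antisymm (hcard ▸ h A₀ hA₀), ?_⟩
  rintro rfl B hB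
  exact hmax ⟨B, hB, rfl⟩

theorem isReconstructionNumber_of_isGreatest : σ.IsReconstructionNumber i (N + 1) := by
  obtain ⟨⟨A₀, hA₀, rfl⟩, hmax⟩ := hN
  constructor
  · intro B hB
    by_contra h
    have hle := hmax ⟨B, h, rfl⟩
    omega
  · intro r hr
    by_contra! hlt
    obtain ⟨B, hBA₀, hB⟩ := Finset.exists_subset_card_eq (Nat.le_of_lt_succ hlt)
    exact hA₀.mono hBA₀ (hr B hB)

end IsGreatest

end RampScheme

section coordSlice

variable {ι : Type*} {α : ι → Type*} [Fintype ι] [DecidableEq ι] [∀ i, DecidableEq (α i)]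

/-- The points of `X` that agree with `x` outside the coordinates in `s`: the intersection of `X`
with an axis-parallel flat through `x`, and with a line for `s = {i}`. -/
def coordSlice (X : Finset (∀ i, α i)) (x : ∀ i, α i) (s : Finset ι) : Finset (∀ i, α i) :=
  {y ∈ X | ∀ k ∉ s, y k = x k}

variable {X : Finset (∀ i, α i)} {x y : ∀ i, α i} {s : Finset ι} {i : ι}

theorem mem_coordSlice : y ∈ coordSlice X x s ↔ y ∈ X ∧ ∀ k ∉ s, y k = x k :=
  Finset.mem_filter

theorem coordSlice_univ : coordSlice X x Finset.univ = X := by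
  simp [coordSlice]

theorem coordSlice_mono {t : Finset ι} (h : s ⊆ t) : coordSlice X x s ⊆ coordSlice X x t :=
  Finset.monotone_filter_right X fun _ _ hy k hk => hy k fun hks => hk (h hks)

theorem card_image_coordSlice_singleton :
    ((coordSlice X x {i}).image (· i)).card = (coordSlice X x {i}).card := by
  refine Finset.card_image_of_injOn fun y hy z hz hyz => funext fun k => ?_
  rcases eq_or_ne k i with rfl | hk
  · exact hyz
  · have hk' : k ∉ ({i} : Finset ι) := Finset.notMem_singleton.2 hk
    rw [(mem_coordSlice.1 hy).2 k hk', (mem_coordSlice.1 hz).2 k hk']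

theorem mul_card_image_coordSlice_insert_le {n : ℕ} (hn : ∀ y ∈ X, n ≤ (coordSlice X y s).card)
    (hi : i ∉ s) :
    n * ((coordSlice X x (insert i s)).image (· i)).card ≤ (coordSlice X x (insert i s)).card := by
  refine Finset.mul_card_image_le_card _ _ fun a ha => ?_
  obtain ⟨y, hy, rfl⟩ := Finset.mem_image.1 ha
  rw [mem_coordSlice] at hy
  refine (hn y hy.1).trans (Finset.card_le_card fun z hz => ?_)
  rw [mem_coordSlice] at hz
  refine Finset.mem_filter.2 ⟨mem_coordSlice.2 ⟨hz.1, fun k hk => ?_⟩, hz.2 i hi⟩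
  rw [hz.2 k fun hks => hk (Finset.mem_insert_of_mem hks), hy.2 k hk]

variable {d : ι → ℕ} (hd : ∀ x ∈ X, ∀ i, d i ≤ (coordSlice X x {i}).card)
include hd

theorem prod_le_card_coordSlice (s : Finset ι) :
    ∀ x ∈ X, ∏ i ∈ s, d i ≤ (coordSlice X x s).card := by
  induction s using Finset.induction_on with
  | empty => exact fun x hx => Finset.one_le_card.2 ⟨x, mem_coordSlice.2 ⟨hx, fun _ _ => rfl⟩⟩
  | insert i s hi ih =>
    intro x hx
    calc ∏ k ∈ insert i s, d k
        = (∏ k ∈ s, d k) * d i := by rw [Finset.prod_insert hi, mul_comm]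
      _ ≤ (∏ k ∈ s, d k) * ((coordSlice X x {i}).image (· i)).card := by
        rw [card_image_coordSlice_singleton]
        exact Nat.mul_le_mul_left _ (hd x hx i)
      _ ≤ (∏ k ∈ s, d k) * ((coordSlice X x (insert i s)).image (· i)).card := by
        gcongr
        exact coordSlice_mono (Finset.singleton_subset_iff.2 (Finset.mem_insert_self i s))
      _ ≤ (coordSlice X x (insert i s)).card := mul_card_image_coordSlice_insert_le ih hi

theorem prod_le_card_of_le_card_coordSlice (hX : X.Nonempty) : ∏ i, d i ≤ X.card := by
  obtain ⟨x, hx⟩ := hX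
  simpa only [coordSlice_univ] using prod_le_card_coordSlice hd Finset.univ x hx

theorem card_image_eval_eq_of_card_le_prod (hpos : ∀ i, 0 < d i) (hX : X.Nonempty)
    (hcard : X.card ≤ ∏ i, d i) (i : ι) : (X.image (· i)).card = d i := by
  obtain ⟨x, hx⟩ := hX
  refine le_antisymm ?_ ?_
  · refine Nat.le_of_mul_le_mul_left ?_
      (Finset.prod_pos fun k (_ : k ∈ Finset.univ.erase i) => hpos k)
    have hle := mul_card_image_coordSlice_insert_le (x := x)
      (prod_le_card_coordSlice hd (Finset.univ.erase i)) (Finset.notMem_erase i _)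
    rw [Finset.insert_erase (Finset.mem_univ i), coordSlice_univ] at hle
    rw [Finset.prod_erase_mul _ _ (Finset.mem_univ i)]
    exact hle.trans hcard
  · calc d i ≤ (coordSlice X x {i}).card := hd x hx i
      _ = ((coordSlice X x {i}).image (· i)).card := card_image_coordSlice_singleton.symm
      _ ≤ (X.image (· i)).card :=
        Finset.card_le_card (Finset.image_subset_image (Finset.filter_subset _ _))

theorem eq_piFinset_image_of_card_le_prod (hpos : ∀ i, 0 < d i) (hX : X.Nonempty)
    (hcard : X.card ≤ ∏ i, d i) : X = Fintype.piFinset fun i => X.image (· i) := by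
  refine Finset.eq_of_subset_of_card_le
    (fun x hx => Fintype.mem_piFinset.2 fun i => Finset.mem_image_of_mem _ hx) ?_
  rw [Fintype.card_piFinset, Finset.prod_congr rfl fun i _ =>
    card_image_eval_eq_of_card_le_prod hd hpos hX hcard i]
  exact prod_le_card_of_le_card_coordSlice hd hX

end coordSlice

section nonzeros

open MvPolynomial

variable {σ R : Type*}

theorem exists_polynomial_eval_eq_eval_update [CommSemiring R] [DecidableEq σ]
    (f : MvPolynomial σ R) (x : σ → R) (i : σ) :
    ∃ p : Polynomial R, p.natDegree ≤ f.degreeOf i ∧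
      ∀ t, p.eval t = eval (Function.update x i t) f := by
  let line : σ → Polynomial R := Function.update (fun k => Polynomial.C (x k)) i Polynomial.X
  have hline : ∀ t, (fun k => (line k).eval t) = Function.update x i t := fun t => by
    ext k
    rcases eq_or_ne k i with rfl | hk <;> simp [line, *]
  have hdeg : ∀ k, (line k).natDegree ≤ if k = i then 1 else 0 := fun k => by
    rcases eq_or_ne k i with rfl | hk
    · simpa [line] using Polynomial.natDegree_X_le
    · simp [line, hk]
  refine ⟨eval₂ Polynomial.C line f, ?_, fun t => ?_⟩
  · rw [eval₂_eq]
    refine Polynomial.natDegree_sum_le_of_forall_le _ _ fun M hM => ?_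
    calc _ ≤ ∑ k ∈ M.support, M k * (line k).natDegree :=
          (Polynomial.natDegree_C_mul_le _ _).trans ((Polynomial.natDegree_prod_le _ _).trans
            (Finset.sum_le_sum fun k _ => Polynomial.natDegree_pow_le))
      _ ≤ ∑ k ∈ M.support, M k * if k = i then 1 else 0 :=
          Finset.sum_le_sum fun k _ => Nat.mul_le_mul_left _ (hdeg k)
      _ ≤ M i := by
          simp only [mul_ite, mul_one, mul_zero, Finset.sum_ite_eq']
          split_ifs <;> omega
      _ ≤ f.degreeOf i := monomial_le_degreeOf i hM
  · have hC : (Polynomial.evalRingHom t).comp Polynomial.C = RingHom.id R := by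
      ext
      simp
    rw [← hline, polynomial_eval_eval₂, hC, eval₂_id]

variable [Fintype σ]

/-- The points of the grid `∏ᵢ Sᵢ` at which `f` does not vanish. -/
noncomputable def nonzeros [CommSemiring R] [DecidableEq σ] [DecidableEq R] (S : σ → Finset R)
    (f : MvPolynomial σ R) : Finset (σ → R) :=
  {x ∈ Fintype.piFinset S | eval x f ≠ 0}

theorem mem_nonzeros [CommSemiring R] [DecidableEq σ] [DecidableEq R] {S : σ → Finset R}
    {f : MvPolynomial σ R} {x : σ → R} :
    x ∈ nonzeros S f ↔ (∀ i, x i ∈ S i) ∧ eval x f ≠ 0 := by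
  rw [nonzeros, Finset.mem_filter, Fintype.mem_piFinset]

variable [CommRing R] [IsDomain R] [DecidableEq R]

theorem card_sub_natDegree_le_card_filter_eval_ne_zero {p : Polynomial R} (hp : p ≠ 0)
    (s : Finset R) : s.card - p.natDegree ≤ {t ∈ s | p.eval t ≠ 0}.card := by
  have hroots : {t ∈ s | p.eval t = 0}.card ≤ p.natDegree :=
    Polynomial.card_le_degree_of_subset_roots fun t ht => by
      simpa [hp] using (Finset.mem_filter.1 ht).2
  have hsum := s.card_filter_add_card_filter_not fun t => p.eval t = 0
  simp only [ne_eq]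
  omega

variable [DecidableEq σ] {S : σ → Finset R} {f : MvPolynomial σ R} {x : σ → R}

theorem card_sub_degreeOf_le_card_coordSlice_nonzeros (hx : x ∈ nonzeros S f) (i : σ) :
    (S i).card - f.degreeOf i ≤ (coordSlice (nonzeros S f) x {i}).card := by
  obtain ⟨hxS, hxf⟩ := mem_nonzeros.1 hx
  obtain ⟨p, hdeg, hp⟩ := exists_polynomial_eval_eq_eval_update f x i
  have hp0 : p ≠ 0 := by
    rintro rfl
    exact hxf (by simpa using (hp (x i)).symm)
  calc (S i).card - f.degreeOf i ≤ (S i).card - p.natDegree := Nat.sub_le_sub_left hdeg _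
    _ ≤ {t ∈ S i | p.eval t ≠ 0}.card := card_sub_natDegree_le_card_filter_eval_ne_zero hp0 _
    _ ≤ (coordSlice (nonzeros S f) x {i}).card := by
      refine Finset.card_le_card_of_injOn (Function.update x i) (fun t ht => ?_)
        (Function.update_injective x i).injOn
      obtain ⟨htS, ht⟩ := Finset.mem_filter.1 ht
      refine mem_coordSlice.2 ⟨mem_nonzeros.2 ⟨fun k => ?_, hp t ▸ ht⟩, fun k hk =>
        Function.update_of_ne (Finset.notMem_singleton.1 hk) _ _⟩
      rcases eq_or_ne k i with rfl | hk
      · rwa [Function.update_self]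
      · rw [Function.update_of_ne hk]
        exact hxS k

section degreeOf_le

variable {d : σ → ℕ} (hd : ∀ i, f.degreeOf i ≤ d i)
include hd

theorem card_sub_le_card_coordSlice_nonzeros (hx : x ∈ nonzeros S f) (i : σ) :
    (S i).card - d i ≤ (coordSlice (nonzeros S f) x {i}).card :=
  (Nat.sub_le_sub_left (hd i) _).trans (card_sub_degreeOf_le_card_coordSlice_nonzeros hx i)

variable (hf : (nonzeros S f).Nonempty)
include hf

theorem prod_card_sub_le_card_nonzeros : ∏ i, ((S i).card - d i) ≤ (nonzeros S f).card :=
  prod_le_card_of_le_card_coordSlice (fun _ => card_sub_le_card_coordSlice_nonzeros hd) hf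

theorem exists_nonzeros_eq_piFinset (hdS : ∀ i, d i < (S i).card)
    (hcard : (nonzeros S f).card ≤ ∏ i, ((S i).card - d i)) :
    ∃ T : σ → Finset R, (∀ i, T i ⊆ S i ∧ (T i).card = (S i).card - d i) ∧
      nonzeros S f = Fintype.piFinset T := by
  have hline : ∀ x ∈ nonzeros S f, ∀ i,
      (S i).card - d i ≤ (coordSlice (nonzeros S f) x {i}).card := fun _ =>
    card_sub_le_card_coordSlice_nonzeros hd
  have hpos : ∀ i, 0 < (S i).card - d i := fun i => Nat.sub_pos_of_lt (hdS i)
  refine ⟨fun i => (nonzeros S f).image (· i), fun i => ⟨?_, ?_⟩, ?_⟩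
  · exact Finset.image_subset_iff.2 fun x hx => (mem_nonzeros.1 hx).1 i
  · exact card_image_eval_eq_of_card_le_prod hline hpos hf hcard i
  · exact eq_piFinset_image_of_card_le_prod hline hpos hf hcard

end degreeOf_le

end nonzeros

section hyperplaneProduct

open MvPolynomial

variable {σ R : Type*} [Fintype σ] [CommRing R]

/-- The product of the linear polynomials `Xᵢ - a` with `a ∈ Zᵢ`, whose zeros are the points with
some coordinate in the corresponding `Zᵢ`. -/
noncomputable def hyperplaneProduct (Z : σ → Finset R) : MvPolynomial σ R :=
  ∏ i, ∏ a ∈ Z i, (X i - C a)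

variable [IsDomain R] {Z : σ → Finset R}

theorem eval_hyperplaneProduct_eq_zero_iff {x : σ → R} :
    eval x (hyperplaneProduct Z) = 0 ↔ ∃ i, x i ∈ Z i := by
  simp [hyperplaneProduct, map_prod, Finset.prod_eq_zero_iff, sub_eq_zero]

theorem degreeOf_hyperplaneProduct_le (i : σ) :
    (hyperplaneProduct Z).degreeOf i ≤ (Z i).card := by
  classical
  have hlin : ∀ k a, (X k - C a : MvPolynomial σ R).degreeOf i ≤ if i = k then 1 else 0 :=
    fun k a => (degreeOf_sub_le _ _ _).trans (by simp [degreeOf_X])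
  calc (hyperplaneProduct Z).degreeOf i
      ≤ ∑ k, ∑ a ∈ Z k, (X k - C a : MvPolynomial σ R).degreeOf i :=
        (degreeOf_prod_le _ _ _).trans (Finset.sum_le_sum fun k _ => degreeOf_prod_le _ _ _)
    _ ≤ ∑ k, ∑ a ∈ Z k, if i = k then 1 else 0 :=
        Finset.sum_le_sum fun k _ => Finset.sum_le_sum fun a _ => hlin k a
    _ = (Z i).card := by simp

theorem coeff_hyperplaneProduct {w : σ →₀ ℕ} (hw : ∀ i, (Z i).card = w i) :
    (hyperplaneProduct Z).coeff w = 1 := by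
  classical
  let _ : LinearOrder σ := linearOrderOfSTO WellOrderingRel
  have hmonic : ∀ i, MonomialOrder.lex.Monic (∏ a ∈ Z i, (X i - C a : MvPolynomial σ R)) :=
    fun i => MonomialOrder.Monic.prod fun a _ => MonomialOrder.monic_X_sub_C _ i a
  have hdegree_factor : ∀ i, MonomialOrder.lex.degree
      (∏ a ∈ Z i, (X i - C a : MvPolynomial σ R)) = Finsupp.single i (w i) := fun i => by
    rw [MonomialOrder.degree_prod fun a _ =>
      (MonomialOrder.monic_X_sub_C MonomialOrder.lex i a).ne_zero]
    simp [MonomialOrder.degree_X_sub_C, hw i]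
  have hdegree : MonomialOrder.lex.degree (hyperplaneProduct Z) = w := by
    rw [hyperplaneProduct, MonomialOrder.degree_prod fun i _ => (hmonic i).ne_zero]
    simp only [hdegree_factor]
    exact Finsupp.univ_sum_single w
  have hcoeff := (MonomialOrder.Monic.prod fun i (_ : i ∈ Finset.univ) => hmonic i).coeff_degree
  rwa [← hyperplaneProduct, hdegree] at hcoeff

end hyperplaneProduct

namespace MonomialCartesian

open MvPolynomial

section Exponents

variable {m : ℕ} {v j j' M : Fin m →₀ ℕ}

theorem mem_delta {s : Fin m → ℕ} : M ∈ delta s ↔ ∀ i, M i < s i := by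
  simp [delta, Finset.mem_finsupp_iff]

theorem mem_L₁ : M ∈ L₁ j ↔ M ≤ j := Finset.mem_Iic

theorem mem_L₂ : M ∈ L₂ v j ↔ M ≤ j ∧ ¬ v ≤ M := by
  simp +contextual [L₂, L₁, box]

theorem L₂_subset_L₁ : L₂ v j ⊆ L₁ j := Finset.sdiff_subset

theorem L₂_mono (h : j ≤ j') : L₂ v j ⊆ L₂ v j' := fun _ hM =>
  mem_L₂.2 ⟨(mem_L₂.1 hM).1.trans h, (mem_L₂.1 hM).2⟩

theorem L₁_subset_delta {s : Fin m → ℕ} (hj : ∀ i, j i < s i) : L₁ j ⊆ delta s := fun _ hM =>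
  mem_delta.2 fun i => (mem_L₁.1 hM i).trans_lt (hj i)

theorem card_box : (box v j).card = ∏ i, (j i + 1 - v i) := by
  simp only [box, Finsupp.card_Icc, Nat.card_Icc]
  refine Finset.prod_subset (Finset.subset_univ _) fun i _ hi => ?_
  rw [Finset.notMem_union, Finsupp.notMem_support_iff, Finsupp.notMem_support_iff] at hi
  rw [hi.1, hi.2, zero_add, Nat.sub_zero]

theorem card_L₁ : (L₁ j).card = ∏ i, (j i + 1) := by
  have hbox : L₁ j = box 0 j := Finset.Icc_bot.symm
  rw [hbox, card_box]
  rfl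

theorem card_L₂_add_card_box : (L₂ v j).card + (box v j).card = (L₁ j).card :=
  Finset.card_sdiff_add_card_eq_card fun _ hM => mem_L₁.2 (Finset.mem_Icc.1 hM).2

theorem add_single_le_of_not_le {i : Fin m} (hvj : v ≤ j) (hMj : M ≤ j) (hM : ¬ v ≤ M)
    (hMi : v ≤ M + Finsupp.single i 1) : M + Finsupp.single i 1 ≤ j := by
  intro k
  rcases eq_or_ne i k with rfl | hk
  · obtain ⟨l, hl⟩ : ∃ l, M l < v l := by simpa [Finsupp.le_def] using hM
    have hvl := hMi l
    rcases eq_or_ne i l with rfl | hil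
    · simp only [Finsupp.add_apply, Finsupp.single_eq_same]
      exact hl.trans_le (hvj i)
    · rw [Finsupp.add_apply, Finsupp.single_eq_of_ne' hil, add_zero] at hvl
      omega
  · rw [Finsupp.add_apply, Finsupp.single_eq_of_ne' hk, add_zero]
    exact hMj k

theorem exists_eq_add_single_of_le_add_single {i : Fin m} (hM : M ≤ j + Finsupp.single i 1)
    (hMj : ¬ M ≤ j) : ∃ N, M = N + Finsupp.single i 1 := by
  suffices h : Finsupp.single i 1 ≤ M from ⟨M - Finsupp.single i 1, (tsub_add_cancel_of_le h).symm⟩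
  obtain ⟨k, hk⟩ : ∃ k, j k < M k := by simpa [Finsupp.le_def] using hMj
  have hki := hM k
  rcases eq_or_ne i k with rfl | hik
  · exact Finsupp.single_le_iff.2 (Nat.one_le_of_lt hk)
  · rw [Finsupp.add_apply, Finsupp.single_eq_of_ne' hik, add_zero] at hki
    omega

end Exponents

section Points

variable {F : Type*} {m : ℕ} {S T : Fin m → Finset F}

theorem card_points (S : Fin m → Finset F) : Fintype.card (Points S) = ∏ i, (S i).card := by
  rw [Fintype.card_coe, Fintype.card_piFinset]

theorem mem_univ_sdiff_prodSet [DecidableEq F] {p : Points S} :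
    p ∈ Finset.univ \ prodSet S T ↔ ∃ i, p.1 i ∉ T i := by
  simp [prodSet]

theorem card_prodSet [DecidableEq F] (hT : ∀ i, T i ⊆ S i) :
    (prodSet S T).card = ∏ i, (T i).card := by
  rw [← Fintype.card_piFinset, ← Finset.card_map (Function.Embedding.subtype _)]
  congr 1
  ext x
  simpa [prodSet] using fun h i => hT i (h i)

theorem card_univ_sdiff_prodSet [DecidableEq F] {w : Fin m →₀ ℕ}
    (hT : ∀ i, T i ⊆ S i ∧ (T i).card = (S i).card - w i) :
    (Finset.univ \ prodSet S T).card = ∏ i, (S i).card - ∏ i, ((S i).card - w i) := by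
  rw [Finset.card_sdiff_of_subset (Finset.subset_univ _), Finset.card_univ, card_points,
    card_prodSet fun i => (hT i).1, Finset.prod_congr rfl fun i _ => (hT i).2]

theorem exists_subset_card_eq_sub (S : Fin m → Finset F) (w : Fin m →₀ ℕ) :
    ∃ T : Fin m → Finset F, ∀ i, T i ⊆ S i ∧ (T i).card = (S i).card - w i := by
  choose T hT using fun i => Finset.exists_subset_card_eq (Nat.sub_le (S i).card (w i))
  exact ⟨T, hT⟩

theorem card_sdiff_of_card_eq_sub [DecidableEq F] {w : Fin m →₀ ℕ}
    (hT : ∀ i, T i ⊆ S i ∧ (T i).card = (S i).card - w i) (hw : ∀ i, w i ≤ (S i).card)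
    (i : Fin m) : (S i \ T i).card = w i := by
  rw [Finset.card_sdiff_of_subset (hT i).1, (hT i).2, Nat.sub_sub_self (hw i)]

end Points

section Code

variable {F : Type*} [Field F] {m : ℕ} {S : Fin m → Finset F} {L L' : Finset (Fin m →₀ ℕ)}
  {f g : MvPolynomial (Fin m) F}

theorem ev_apply (S : Fin m → Finset F) (f : MvPolynomial (Fin m) F) (p : Points S) :
    ev S f p = eval p.1 f := by
  simp [ev, aeval_eq_eval]

theorem ev_mul (f g : MvPolynomial (Fin m) F) : ev S (f * g) = ev S f * ev S g := by
  ext p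
  simp only [ev_apply, Pi.mul_apply, map_mul]

theorem code_eq_map_restrictSupport (S : Fin m → Finset F) (L : Finset (Fin m →₀ ℕ)) :
    code S L = (restrictSupport F (L : Set (Fin m →₀ ℕ))).map (ev S) := by
  rw [code, restrictSupport_eq_span]

theorem mem_code {c : Points S → F} : c ∈ code S L ↔ ∃ f, f.support ⊆ L ∧ ev S f = c := by
  simp [code_eq_map_restrictSupport, mem_restrictSupport_iff]

theorem ev_mem_code (hf : f.support ⊆ L) : ev S f ∈ code S L := mem_code.2 ⟨f, hf, rfl⟩

theorem code_mono (h : L ⊆ L') : code S L ≤ code S L' := fun c hc => by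
  obtain ⟨f, hf, rfl⟩ := mem_code.1 hc
  exact ev_mem_code (hf.trans h)

theorem ev_monomial_mem_code {M : Fin m →₀ ℕ} (hM : M ∈ L) :
    ev S (monomial M (1 : F)) ∈ code S L :=
  Submodule.mem_map_of_mem (Submodule.subset_span ⟨M, hM, rfl⟩)

theorem code_le_iff {W : Submodule F (Points S → F)} :
    code S L ≤ W ↔ ∀ M ∈ L, ev S (monomial M (1 : F)) ∈ W := by
  rw [code, Submodule.map_span_le, Set.forall_mem_image]
  rfl

theorem eq_zero_of_ev_eq_zero (hf : f.support ⊆ delta fun i => (S i).card) (h : ev S f = 0) :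
    f = 0 := by
  by_contra hne
  obtain ⟨M, hM⟩ := support_nonempty.2 hne
  refine hne (eq_zero_of_eval_zero_at_prod_finset f S (fun i => ?_) fun x hx => ?_)
  · rw [degreeOf_lt_iff (Nat.zero_lt_of_lt (mem_delta.1 (hf hM) i))]
    exact fun N hN => mem_delta.1 (hf hN) i
  · rw [← ev_apply S f ⟨x, Fintype.mem_piFinset.2 hx⟩, h, Pi.zero_apply]

theorem ev_mem_code_iff (hf : f.support ⊆ delta fun i => (S i).card)
    (hL : L ⊆ delta fun i => (S i).card) : ev S f ∈ code S L ↔ f.support ⊆ L := by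
  classical
  refine ⟨fun h => ?_, ev_mem_code⟩
  obtain ⟨g, hg, hgf⟩ := mem_code.1 h
  have hsub : (g - f).support ⊆ delta fun i => (S i).card :=
    (support_sub _ g f).trans (Finset.union_subset (hg.trans hL) hf)
  rwa [← sub_eq_zero.1 (eq_zero_of_ev_eq_zero hsub (by rw [map_sub, hgf, sub_self]))]

theorem finrank_code (hL : L ⊆ delta fun i => (S i).card) :
    Module.finrank F (code S L) = L.card := by
  rw [code_eq_map_restrictSupport, ← LinearMap.range_domRestrict, LinearMap.finrank_range_of_inj,
    Module.finrank_eq_card_basis (basisRestrictSupport F (L : Set (Fin m →₀ ℕ)))]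
  · exact Fintype.card_coe L
  · exact (injective_iff_map_eq_zero _).2 fun f hf =>
      Subtype.ext (eq_zero_of_ev_eq_zero ((Finset.coe_subset.1 f.2).trans hL) hf)

theorem code_L₁_eq_top {j : Fin m →₀ ℕ} (hj : ∀ i, j i + 1 = (S i).card) :
    code S (L₁ j) = ⊤ := by
  refine Submodule.eq_top_of_finrank_eq ?_
  rw [finrank_code (L₁_subset_delta fun i => (hj i).le), card_L₁,
    Module.finrank_fintype_fun_eq_card, card_points, Finset.prod_congr rfl fun i _ => hj i]

theorem support_hyperplaneProduct_subset_L₁ {Z : Fin m → Finset F} {w : Fin m →₀ ℕ}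
    (hw : ∀ i, (Z i).card = w i) : (hyperplaneProduct Z).support ⊆ L₁ w := fun _ hM =>
  mem_L₁.2 fun i => (monomial_le_degreeOf i hM).trans
    ((degreeOf_hyperplaneProduct_le i).trans (hw i).le)

theorem ev_hyperplaneProduct_mem_vanishingWords [DecidableEq F] (S T : Fin m → Finset F) :
    ev S (hyperplaneProduct fun i => S i \ T i) ∈
      vanishingWords F (Finset.univ \ prodSet S T) := by
  refine mem_vanishingWords.2 fun p hp => ?_
  obtain ⟨i, hi⟩ := mem_univ_sdiff_prodSet.1 hp
  rw [ev_apply, eval_hyperplaneProduct_eq_zero_iff]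
  exact ⟨i, Finset.mem_sdiff.2 ⟨Fintype.mem_piFinset.1 p.2 i, hi⟩⟩

end Code

section NonQualifyingOne

variable {F : Type*} [Field F] {m : ℕ} {S : Fin m → Finset F} {v j j' : Fin m →₀ ℕ}
  {A : Finset (Points S)}

theorem code_L₁_add_single_le_sup_vanishingWords (hvj : v ≤ j)
    (h : code S (L₁ j) ≤ code S (L₂ v j) ⊔ vanishingWords F A) (i : Fin m) :
    code S (L₁ (j + Finsupp.single i 1)) ≤
      code S (L₂ v (j + Finsupp.single i 1)) ⊔ vanishingWords F A := by
  set W := code S (L₂ v (j + Finsupp.single i 1)) ⊔ vanishingWords F A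
  have hle : code S (L₁ j) ≤ W := h.trans (sup_le_sup_right (code_mono (L₂_mono le_self_add)) _)
  have hold : ∀ M ≤ j, ev S (monomial M 1) ∈ W := fun M hM =>
    hle (ev_monomial_mem_code (mem_L₁.2 hM))
  have hX : ∀ N, ev S (monomial (N + Finsupp.single i 1) (1 : F)) =
      ev S (X i) * ev S (monomial N 1) := fun N => by
    rw [← ev_mul, mul_comm, monomial_add_single, pow_one]
  have hmul : code S (L₂ v j) ⊔ vanishingWords F A ≤
      W.comap (LinearMap.mulLeft F (ev S (X i))) := by
    refine sup_le (code_le_iff.2 fun N hN => ?_) fun c hc =>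
      Submodule.mem_sup_right (mul_mem_vanishingWords _ hc)
    rw [mem_L₂] at hN
    rw [Submodule.mem_comap, LinearMap.mulLeft_apply, ← hX]
    by_cases hvN : v ≤ N + Finsupp.single i 1
    · exact hold _ (add_single_le_of_not_le hvj hN.1 hN.2 hvN)
    · exact Submodule.mem_sup_left
        (ev_monomial_mem_code (mem_L₂.2 ⟨add_le_add_left hN.1 _, hvN⟩))
  refine code_le_iff.2 fun M hM => ?_
  rw [mem_L₁] at hM
  by_cases hMj : M ≤ j
  · exact hold M hMj
  · obtain ⟨N, rfl⟩ := exists_eq_add_single_of_le_add_single hM hMj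
    rw [hX]
    exact hmul (h (ev_monomial_mem_code (mem_L₁.2 (le_of_add_le_add_right hM))))

theorem code_L₁_le_sup_vanishingWords_of_le (hvj : v ≤ j) (hjj' : j ≤ j')
    (h : code S (L₁ j) ≤ code S (L₂ v j) ⊔ vanishingWords F A) :
    code S (L₁ j') ≤ code S (L₂ v j') ⊔ vanishingWords F A := by
  obtain ⟨u, rfl⟩ := exists_add_of_le hjj'
  clear hjj'
  induction u using Finsupp.induction_linear generalizing j with
  | zero => rwa [add_zero]
  | add u w hu hw =>
    rw [← add_assoc]
    exact hw (hvj.trans le_self_add) (hu hvj h)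
  | single i n =>
    induction n with
    | zero => rwa [Finsupp.single_zero, add_zero]
    | succ n ih =>
      rw [Finsupp.single_add, ← add_assoc]
      exact code_L₁_add_single_le_sup_vanishingWords (hvj.trans le_self_add) ih i

theorem card_le_of_code_L₁_le_sup_vanishingWords (hvj : v ≤ j) (hjs : ∀ i, j i < (S i).card)
    (h : code S (L₁ j) ≤ code S (L₂ v j) ⊔ vanishingWords F A) :
    A.card ≤ ∏ i, (S i).card - ∏ i, ((S i).card - v i) := by
  let j' : Fin m →₀ ℕ := Finsupp.equivFunOnFinite.symm fun i => (S i).card - 1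
  have hj' : ∀ i, j' i + 1 = (S i).card := fun i =>
    Nat.sub_add_cancel (Nat.zero_lt_of_lt (hjs i))
  have hjj' : j ≤ j' := fun i => Nat.le_sub_one_of_lt (hjs i)
  have htop : code S (L₂ v j') ⊔ vanishingWords F A = ⊤ :=
    top_le_iff.1 (code_L₁_eq_top hj' ▸
      code_L₁_le_sup_vanishingWords_of_le hvj hjj' h)
  have hcard := card_L₂_add_card_box (v := v) (j := j')
  simp only [card_L₁, card_box, hj'] at hcard
  calc A.card ≤ Module.finrank F (code S (L₂ v j')) :=
        card_le_finrank_of_sup_vanishingWords_eq_top htop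
    _ = (L₂ v j').card :=
        finrank_code (L₂_subset_L₁.trans (L₁_subset_delta fun i => (hj' i).le))
    _ = ∏ i, (S i).card - ∏ i, ((S i).card - v i) := by rw [← hcard, Nat.add_sub_cancel]

variable [DecidableEq F] {T : Fin m → Finset F}

theorem code_L₁_le_sup_vanishingWords_univ_sdiff_prodSet (hT : ∀ i, (S i \ T i).card = v i)
    (hvj : v ≤ j) :
    code S (L₁ j) ≤ code S (L₂ v j) ⊔ vanishingWords F (Finset.univ \ prodSet S T) := by
  refine code_L₁_le_sup_vanishingWords_of_le le_rfl hvj (code_le_iff.2 fun M hM => ?_)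
  rw [mem_L₁] at hM
  by_cases hvM : v ≤ M
  · obtain rfl := hM.antisymm hvM
    set g := hyperplaneProduct fun i => S i \ T i
    have hsupp : (monomial M 1 - g).support ⊆ L₂ M M := fun N hN => by
      have hne : N ≠ M := by
        rintro rfl
        simp [g, coeff_hyperplaneProduct hT] at hN
      rw [mem_support_iff, coeff_sub, coeff_monomial, if_neg hne.symm, zero_sub, neg_ne_zero,
        ← mem_support_iff] at hN
      have hNM := mem_L₁.1 (support_hyperplaneProduct_subset_L₁ hT hN)
      exact mem_L₂.2 ⟨hNM, fun hMN => hne (hNM.antisymm hMN)⟩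
    rw [← sub_add_cancel (monomial M 1) g, map_add]
    exact Submodule.add_mem_sup (ev_mem_code hsupp) (ev_hyperplaneProduct_mem_vanishingWords S T)
  · exact Submodule.mem_sup_left (ev_monomial_mem_code (mem_L₂.2 ⟨hM, hvM⟩))

theorem nonQualifying_one_univ_sdiff_prodSet {k₂ ℓ : ℕ}
    (σ : RampScheme (code S (L₂ v j)) (code S (L₁ j)) k₂ ℓ) (hvj : v ≤ j)
    (hvS : ∀ i, v i ≤ (S i).card) (hT : ∀ i, T i ⊆ S i ∧ (T i).card = (S i).card - v i) :
    σ.NonQualifying 1 (Finset.univ \ prodSet S T) :=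
  RampScheme.nonQualifying_one_iff.2
    (code_L₁_le_sup_vanishingWords_univ_sdiff_prodSet (card_sdiff_of_card_eq_sub hT hvS) hvj)

omit [DecidableEq F] in
theorem isGreatest_card_nonQualifying_one {k₂ ℓ : ℕ}
    (σ : RampScheme (code S (L₂ v j)) (code S (L₁ j)) k₂ ℓ) (hvj : v ≤ j)
    (hjs : ∀ i, j i < (S i).card) :
    IsGreatest {n | ∃ A, σ.NonQualifying 1 A ∧ A.card = n}
      (∏ i, (S i).card - ∏ i, ((S i).card - v i)) := by
  classical
  constructor
  · obtain ⟨T, hT⟩ := exists_subset_card_eq_sub S v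
    exact ⟨_, nonQualifying_one_univ_sdiff_prodSet σ hvj (fun i => (hvj i).trans (hjs i).le) hT,
      card_univ_sdiff_prodSet hT⟩
  · rintro _ ⟨A, hA, rfl⟩
    exact card_le_of_code_L₁_le_sup_vanishingWords hvj hjs (RampScheme.nonQualifying_one_iff.1 hA)

end NonQualifyingOne

section NonQualifyingCodim

variable {F : Type*} [Field F] [DecidableEq F] {m : ℕ} {S T : Fin m → Finset F}
  {v j : Fin m →₀ ℕ} {A : Finset (Points S)} {f : MvPolynomial (Fin m) F}

theorem nonzeros_nonempty_of_ev_ne_zero (hf : ev S f ≠ 0) : (nonzeros S f).Nonempty := by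
  obtain ⟨p, hp⟩ := Function.ne_iff.1 hf
  exact ⟨p.1, mem_nonzeros.2 ⟨Fintype.mem_piFinset.1 p.2, ev_apply S f p ▸ hp⟩⟩

theorem card_add_card_nonzeros_le (hA : ev S f ∈ vanishingWords F A) :
    A.card + (nonzeros S f).card ≤ ∏ i, (S i).card := by
  have hdisj : Disjoint (A.map (Function.Embedding.subtype _)) (nonzeros S f) := by
    refine Finset.disjoint_left.2 fun x hx hxf => ?_
    obtain ⟨p, hp, rfl⟩ := Finset.mem_map.1 hx
    exact (mem_nonzeros.1 hxf).2 (ev_apply S f p ▸ mem_vanishingWords.1 hA p hp)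
  rw [← Fintype.card_piFinset, ← Finset.card_map (Function.Embedding.subtype _),
    ← Finset.card_union_of_disjoint hdisj]
  refine Finset.card_le_card (Finset.union_subset ?_ (Finset.filter_subset _ _))
  exact fun x hx => Finset.property_of_mem_map_subtype A hx

theorem subset_univ_sdiff_prodSet (hA : ev S f ∈ vanishingWords F A)
    (hT : nonzeros S f = Fintype.piFinset T) : A ⊆ Finset.univ \ prodSet S T := fun p hp => by
  rw [mem_univ_sdiff_prodSet, ← not_forall, ← Fintype.mem_piFinset, ← hT, mem_nonzeros]
  exact fun h => h.2 (ev_apply S f p ▸ mem_vanishingWords.1 hA p hp)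

variable {k₂ ℓ : ℕ} {σ : RampScheme (code S (L₂ v j)) (code S (L₁ j)) k₂ ℓ}

theorem exists_ev_mem_vanishingWords_of_nonQualifying (hA : σ.NonQualifying ℓ A) :
    ∃ f : MvPolynomial (Fin m) F, (∀ i, f.degreeOf i ≤ j i) ∧ (nonzeros S f).Nonempty ∧
      ev S f ∈ vanishingWords F A := by
  obtain ⟨c, ⟨hc, hcA⟩, hc₂⟩ :=
    SetLike.not_le_iff_exists.1 (RampScheme.nonQualifying_codim_iff.1 hA)
  obtain ⟨f, hf, rfl⟩ := mem_code.1 hc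
  refine ⟨f, fun i => degreeOf_le_iff.2 fun M hM => mem_L₁.1 (hf hM) i,
    nonzeros_nonempty_of_ev_ne_zero ?_, hcA⟩
  exact fun h0 => hc₂ (h0 ▸ Submodule.zero_mem _)

theorem exists_eq_univ_sdiff_prodSet (hjs : ∀ i, j i < (S i).card) (hA : σ.NonQualifying ℓ A)
    (hcard : A.card = ∏ i, (S i).card - ∏ i, ((S i).card - j i)) :
    ∃ T : Fin m → Finset F, (∀ i, T i ⊆ S i ∧ (T i).card = (S i).card - j i) ∧
      A = Finset.univ \ prodSet S T := by
  obtain ⟨f, hdeg, hne, hfA⟩ := exists_ev_mem_vanishingWords_of_nonQualifying hA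
  have hle : (nonzeros S f).card ≤ ∏ i, ((S i).card - j i) := by
    have hsum := card_add_card_nonzeros_le hfA
    omega
  obtain ⟨T, hT, hfT⟩ := exists_nonzeros_eq_piFinset hdeg hne hjs hle
  exact ⟨T, hT, Finset.eq_of_subset_of_card_le (subset_univ_sdiff_prodSet hfA hfT)
    (by rw [hcard, card_univ_sdiff_prodSet hT])⟩

variable (σ)

theorem nonQualifying_codim_univ_sdiff_prodSet (hvj : v ≤ j) (hjs : ∀ i, j i < (S i).card)
    (hT : ∀ i, T i ⊆ S i ∧ (T i).card = (S i).card - j i) :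
    σ.NonQualifying ℓ (Finset.univ \ prodSet S T) := by
  have hR := card_sdiff_of_card_eq_sub hT fun i => (hjs i).le
  have hsupp := support_hyperplaneProduct_subset_L₁ hR
  have hdelta := L₁_subset_delta hjs
  refine RampScheme.nonQualifying_codim_iff.2 fun hle => ?_
  have hmem := hle ⟨ev_mem_code hsupp, ev_hyperplaneProduct_mem_vanishingWords S T⟩
  rw [ev_mem_code_iff (hsupp.trans hdelta) (L₂_subset_L₁.trans hdelta)] at hmem
  have hj : j ∈ (hyperplaneProduct fun i => S i \ T i).support := by
    rw [mem_support_iff, coeff_hyperplaneProduct hR]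
    exact one_ne_zero
  exact (mem_L₂.1 (hmem hj)).2 hvj

omit [DecidableEq F] in
theorem isGreatest_card_nonQualifying_codim (hvj : v ≤ j) (hjs : ∀ i, j i < (S i).card) :
    IsGreatest {n | ∃ A, σ.NonQualifying ℓ A ∧ A.card = n}
      (∏ i, (S i).card - ∏ i, ((S i).card - j i)) := by
  classical
  constructor
  · obtain ⟨T, hT⟩ := exists_subset_card_eq_sub S j
    exact ⟨_, nonQualifying_codim_univ_sdiff_prodSet σ hvj hjs hT, card_univ_sdiff_prodSet hT⟩
  · rintro _ ⟨A, hA, rfl⟩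
    obtain ⟨f, hdeg, hne, hfA⟩ := exists_ev_mem_vanishingWords_of_nonQualifying hA
    exact Nat.le_sub_of_add_le ((Nat.add_le_add_left
      (prod_card_sub_le_card_nonzeros hdeg hne) _).trans (card_add_card_nonzeros_le hfA))

end NonQualifyingCodim

theorem eq_card_box {F : Type*} [Field F] {m : ℕ} {S : Fin m → Finset F} {v j : Fin m →₀ ℕ}
    (hjs : ∀ i, j i < (S i).card) {k₂ ℓ : ℕ}
    (σ : RampScheme (code S (L₂ v j)) (code S (L₁ j)) k₂ ℓ) : ℓ = (box v j).card := by
  have hdelta := L₁_subset_delta hjs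
  have hfinrank := σ.finrank_eq_add
  rw [finrank_code hdelta, finrank_code (L₂_subset_L₁.trans hdelta),
    ← card_L₂_add_card_box (v := v)] at hfinrank
  exact (Nat.add_left_cancel hfinrank).symm

end MonomialCartesian

theorem mainTheorem2_general {F : Type*} [Field F] [DecidableEq F] {m : ℕ}
    (S : Fin m → Finset F) (v j : Fin m →₀ ℕ)
    (hvj : v ≤ j) (hjs : ∀ i, j i < (S i).card) {k₂ ℓ : ℕ}
    (σ : RampScheme (MonomialCartesian.code S (MonomialCartesian.L₂ v j))
      (MonomialCartesian.code S (MonomialCartesian.L₁ j)) k₂ ℓ) :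
    ℓ = (MonomialCartesian.box v j).card ∧
    σ.IsReconstructionNumber 1
      ((∏ i, (S i).card) - (∏ i, ((S i).card - v i)) + 1) ∧
    σ.IsReconstructionNumber ℓ
      ((∏ i, (S i).card) - (∏ i, ((S i).card - j i)) + 1) ∧
    (∀ T : Fin m → Finset F,
      (∀ i, T i ⊆ S i ∧ (T i).card = (S i).card - v i) →
        σ.MaximumNonQualifying 1 (Finset.univ \ MonomialCartesian.prodSet S T)) ∧
    (∀ A : Finset (MonomialCartesian.Points S),
      σ.MaximumNonQualifying ℓ A ↔
        ∃ T : Fin m → Finset F,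
          (∀ i, T i ⊆ S i ∧ (T i).card = (S i).card - j i) ∧
          A = Finset.univ \ MonomialCartesian.prodSet S T) := by
  have hone := MonomialCartesian.isGreatest_card_nonQualifying_one σ hvj hjs
  have hcodim := MonomialCartesian.isGreatest_card_nonQualifying_codim σ hvj hjs
  refine ⟨MonomialCartesian.eq_card_box hjs σ,
    RampScheme.isReconstructionNumber_of_isGreatest hone,
    RampScheme.isReconstructionNumber_of_isGreatest hcodim, fun T hT => ?_, fun A => ?_⟩
  · exact (RampScheme.maximumNonQualifying_iff_of_isGreatest hone).2
      ⟨MonomialCartesian.nonQualifying_one_univ_sdiff_prodSet σ hvj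
        (fun i => (hvj i).trans (hjs i).le) hT, MonomialCartesian.card_univ_sdiff_prodSet hT⟩
  · rw [RampScheme.maximumNonQualifying_iff_of_isGreatest hcodim]
    constructor
    · exact fun ⟨hA, hcard⟩ => MonomialCartesian.exists_eq_univ_sdiff_prodSet hjs hA hcard
    · rintro ⟨T, hT, rfl⟩
      exact ⟨MonomialCartesian.nonQualifying_codim_univ_sdiff_prodSet σ hvj hjs hT,
        MonomialCartesian.card_univ_sdiff_prodSet hT⟩

theorem mainTheorem2 {F : Type*} [Field F] [Fintype F] [DecidableEq F] {m : ℕ}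
    (S : Fin m → Finset F) (v j : Fin m →₀ ℕ)
    (hvj : ∀ i, v i < j i) (hjs : ∀ i, j i < (S i).card)
    (hcons : MonomialCartesian.Considerate (fun i => (S i).card) v j)
    {k₂ ℓ : ℕ}
    (σ : RampScheme (MonomialCartesian.code S (MonomialCartesian.L₂ v j))
      (MonomialCartesian.code S (MonomialCartesian.L₁ j)) k₂ ℓ) :
    ℓ = (MonomialCartesian.box v j).card ∧
    σ.IsReconstructionNumber 1
      ((∏ i, (S i).card) - (∏ i, ((S i).card - v i)) + 1) ∧
    σ.IsReconstructionNumber ℓ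
      ((∏ i, (S i).card) - (∏ i, ((S i).card - j i)) + 1) ∧
    (∀ T : Fin m → Finset F,
      (∀ i, T i ⊆ S i ∧ (T i).card = (S i).card - v i) →
        σ.MaximumNonQualifying 1 (Finset.univ \ MonomialCartesian.prodSet S T)) ∧
    (∀ A : Finset (MonomialCartesian.Points S),
      σ.MaximumNonQualifying ℓ A ↔
        ∃ T : Fin m → Finset F,
          (∀ i, T i ⊆ S i ∧ (T i).card = (S i).card - j i) ∧
          A = Finset.univ \ MonomialCartesian.prodSet S T) :=
  mainTheorem2_general S v j (fun i => (hvj i).le) hjs σ
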